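/- Let $\overline{\mathbb R}:=\mathbb R\cup\{+\infty\}$ and equip $\mathbb R^n$ and $\mathbb R^n\times\mathbb R$ with the Euclidean norm and inner product. For a set $A$, let $T_A(x)$ be its Bouligand tangent cone at $x\in A$ (all $w$ for which there are $t_k\downarrow 0$ and $w_k\to w$ with $x+t_kw_k\in A$), let $\hat N_A(x)=\{v:\langle v,w\rangle\le 0\ \forall w\in T_A(x)\}$, and let $N_A(x)$ be the set of all limits of sequences $v_k\in\hat N_A(x_k)$ with $x_k\in A$, $x_k\to x$. Put $\sigma_A(w):=\sup_{x\in A}\langle x,w\rangle$, $d(x,A):=\inf_{y\in A}\|y-x\|$ with $d(x,\emptyset):=+\infty$, and $\operatorname{end}(A):=\{x\in\operatorname{cl}A : tx\notin\operatorname{cl}A\ \forall t>1\}$. For an extended real-valued function $g$ on $\mathbb R^n$ and a point $x$ with $g(x)$ finite: - $\hat\partial g(x)$ is the set of $v$ with $g(y)\ge g(x)+\langle v,y-x\rangle+o(\|y-x\|)$ as $y\to x$; - $\partial g(x)$ is the set of limits of sequences $v_k\in\hat\partial g(x_k)$ with $x_k\to x$, $g(x_k)\to g(x)$; - $\partial^{>}g(x)$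 (the outer limiting subdifferential) is the set of limits of sequences $v_k\in\partial g(x_k)$ with $x_k\to x$, $g(x_k)\to g(x)$, $g(x_k)>g(x)$ for all $k$; - $g$ is regular at $x$ if $\operatorname{epi}g=\{(y,\alpha)\in\mathbb R^n\times\mathbb R: g(y)\le\alpha\}$ is locally closed at $p=(x,g(x))$ (that is, $\operatorname{epi}g\cap U$ is closed for some closed neighbourhood $U$ of $p$) and $\hat N_{\operatorname{epi}g}(p)=N_{\operatorname{epi}g}(p)$; - $g$ is locally Lipschitz continuous at $x$ if it is finite and Lipschitz continuous on a neighbourhood of $x$. Write $[\phi\le 0]:=\{x\in\mathbb R^n:\phi(x)\le 0\}$. The local error bound modulus $\operatorname{ebm}(\phi,\bar x)\in[0,+\infty]$ is the supremum of all $\tau>0$ for which there is a neighbourhood $U$ of $\bar x$ with $\tau\,d(x,[\phi\le 0])\le\max\{\phi(x),0\}$ for all $x\in U$, and it is $0$ if there is no such $\tau$. **Theorem.** Let $\phi:\mathbb R^n\to\overline{\mathbb R}$ and let $\bar x$ be a point on the boundary of $[\phi\le 0]$. If $\phi$ is regular and locally Lipschitz continuous at $\bar x$, then $$d\bigl(0,\partial^{>}\phi(\bar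 x)\bigr)\ \le\ \operatorname{ebm}(\phi,\bar x)\ \le\ d\bigl(0,\partial^{>}\sigma_{\partial\phi(\bar x)}(0)\bigr),$$ and the upper bound satisfies $$d\bigl(0,\partial^{>}\sigma_{\partial\phi(\bar x)}(0)\bigr)=d\bigl(0,\operatorname{end}(\partial\phi(\bar x))\bigr).$$ -/

import Mathlib

open Filter Topology
open scoped ENNReal NNReal

namespace ErrorBound

section Sets

variable {E : Type*} [NormedAddCommGroup E] [InnerProductSpace ℝ E]

/-- The polar cone `A* = {v | ⟨v, x⟩ ≤ 0 for all x ∈ A}`. -/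
def polarCone (A : Set E) : Set E :=
  {v | ∀ x ∈ A, inner ℝ v x ≤ 0}

/-- The (Bouligand) tangent cone `T_A(x)`: `w ∈ T_A(x)` if there are `t_k ↓ 0` and `w_k → w`
with `x + t_k w_k ∈ A` for all `k`. -/
def tangentCone (A : Set E) (x : E) : Set E :=
  {w | ∃ (t : ℕ → ℝ) (u : ℕ → E), (∀ k, 0 < t k) ∧ Tendsto t atTop (𝓝 0) ∧
    Tendsto u atTop (𝓝 w) ∧ ∀ k, x + t k • u k ∈ A}

/-- The regular normal cone: the polar of the tangent cone. -/
def regularNormalCone (A : Set E) (x : E) : Set E :=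
  polarCone (tangentCone A x)

/-- The normal cone `N_A(x)`: limits of regular normals at points of `A` converging to `x`. -/
def normalCone (A : Set E) (x : E) : Set E :=
  {v | ∃ (y : ℕ → E) (u : ℕ → E), (∀ k, y k ∈ A) ∧ Tendsto y atTop (𝓝 x) ∧
    (∀ k, u k ∈ regularNormalCone A (y k)) ∧ Tendsto u atTop (𝓝 v)}

/-- `A` is locally closed at `x ∈ A`: `A ∩ U` is closed for some closed neighbourhood `U`
of `x`. -/
def IsLocallyClosedAt (A : Set E) (x : E) : Prop :=
  x ∈ A ∧ ∃ U ∈ 𝓝 x, IsClosed U ∧ IsClosed (A ∩ U)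

/-- Regularity of the set `A` at `x` in the sense of Clarke. -/
def IsClarkeRegularAt (A : Set E) (x : E) : Prop :=
  IsLocallyClosedAt A x ∧ regularNormalCone A x = normalCone A x

/-- The support function `σ_A(w) = sup_{x ∈ A} ⟨x, w⟩`. -/
noncomputable def supportFunction (A : Set E) (w : E) : EReal :=
  ⨆ x ∈ A, ((inner ℝ x w : ℝ) : EReal)

/-- The end set `{x ∈ cl A | t x ∉ cl A for all t > 1}`. -/
def endSet (A : Set E) : Set E :=
  {x | x ∈ closure A ∧ ∀ t : ℝ, 1 < t → t • x ∉ closure A}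

end Sets

section Functions

variable {E : Type*} [NormedAddCommGroup E] [InnerProductSpace ℝ E]

/-- The value `g x` is a real number. -/
def IsFiniteAt (g : E → EReal) (x : E) : Prop :=
  g x ≠ ⊤ ∧ g x ≠ ⊥

/-- The epigraph of `g`, as a subset of `E × ℝ` with the Euclidean (`ℓ²`) product structure. -/
def epigraph (g : E → EReal) : Set (WithLp 2 (E × ℝ)) :=
  {p | g p.fst ≤ ((p.snd : ℝ) : EReal)}

/-- `g` is (subdifferentially) regular at `x`: `g x` is finite, and the epigraph is Clarke regular
at `(x, g x)`. -/
def IsRegularAt (g : E → EReal) (x : E) : Prop :=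
  IsFiniteAt g x ∧ IsClarkeRegularAt (epigraph g) (WithLp.toLp 2 (x, (g x).toReal))

/-- `g` is locally Lipschitz continuous at `x`: finite and Lipschitz on a neighbourhood of `x`. -/
def IsLocallyLipschitzAt (g : E → EReal) (x : E) : Prop :=
  ∃ K : ℝ≥0, ∃ U ∈ 𝓝 x, (∀ y ∈ U, IsFiniteAt g y) ∧
    LipschitzOnWith K (fun y => (g y).toReal) U

/-- Regular subgradients of `g` at a point `x` where `g` is finite:
`g y ≥ g x + ⟨v, y - x⟩ + o(‖y - x‖)`. -/
def regularSubdifferential (g : E → EReal) (x : E) : Set E :=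
  {v | IsFiniteAt g x ∧ ∀ ε : ℝ, 0 < ε → ∀ᶠ y in 𝓝 x,
    (((g x).toReal + inner ℝ v (y - x) - ε * ‖y - x‖ : ℝ) : EReal) ≤ g y}

/-- (General, limiting) subgradients of `g` at a point `x` where `g` is finite. -/
def subdifferential (g : E → EReal) (x : E) : Set E :=
  {v | IsFiniteAt g x ∧ ∃ (y : ℕ → E) (u : ℕ → E), Tendsto y atTop (𝓝 x) ∧
    Tendsto (fun k => g (y k)) atTop (𝓝 (g x)) ∧
    (∀ k, u k ∈ regularSubdifferential g (y k)) ∧ Tendsto u atTop (𝓝 v)}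

/-- The outer limiting subdifferential `∂^> g(x)`, at a point `x` where `g` is finite. -/
def outerLimitingSubdifferential (g : E → EReal) (x : E) : Set E :=
  {v | IsFiniteAt g x ∧ ∃ (y : ℕ → E) (u : ℕ → E), Tendsto y atTop (𝓝 x) ∧
    Tendsto (fun k => g (y k)) atTop (𝓝 (g x)) ∧ (∀ k, g x < g (y k)) ∧
    (∀ k, u k ∈ subdifferential g (y k)) ∧ Tendsto u atTop (𝓝 v)}

/-- The level set `[g ≤ 0]`. -/
def levelSet (g : E → EReal) : Set E :=
  {x | g x ≤ 0}

/-- `τ > 0` is a local error bound constant of `g` at `x`: for all `y` near `x`,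
`τ d(y, [g ≤ 0]) ≤ max (g y) 0`. -/
def IsErrorBoundConstant (g : E → EReal) (x : E) (τ : ℝ≥0) : Prop :=
  0 < τ ∧ ∃ U ∈ 𝓝 x, ∀ y ∈ U,
    (((τ : ℝ≥0∞) * Metric.infEDist y (levelSet g) : ℝ≥0∞) : EReal) ≤ max (g y) 0

/-- The local error bound modulus of `g` at `x`: the supremum of all local error bound constants,
and `0` (the supremum of the empty set in `[0, ∞]`) if there are none. -/
noncomputable def ebm (g : E → EReal) (x : E) : ℝ≥0∞ :=
  ⨆ (τ : ℝ≥0) (_ : IsErrorBoundConstant g x τ), (τ : ℝ≥0∞)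

end Functions

end ErrorBound

namespace ErrorBound

section

variable {E : Type*} [NormedAddCommGroup E] [InnerProductSpace ℝ E]

/-! Let `D` be the subdifferential of `φ` at `x̄`. Regularity makes every limiting subgradient
regular (`IsRegularAt.subdifferential_eq`), so `D` is convex; the Lipschitz bound makes it compact.
Both forms of the upper bound equal the distance from 0 to `positivelySupportedSet D`: this set lies
in the end set of `D` and in the outer limiting subdifferential of its support function at 0, and
each of these lies in its closure.

Lower bound (`exists_regularSubgradient_norm_le`): if the constant `τ` fails at points `z → x̄`,
minimizing `max φ 0` plus `τ` times a smoothed distance to `z` gives points outside the level set,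
near `x̄`, with regular subgradients of norm at most `τ`. A cluster point of these is an outer
limiting subgradient.

Upper bound (`le_norm_of_isErrorBoundConstant`): let `v ∈ D` maximize `⟨·, w⟩` over `D` with value
`m > 0`. By a mean value inequality, `φ(x̄ + tw) ≤ t m + o(t)`, so an error bound constant `τ` gives
a point `z` of the level set within `t m / τ + o(t)` of `x̄ + tw`. Since `φ(z) ≤ 0` and `v` is a
regular subgradient, `⟨v, z - x̄⟩ ≤ o(t)`. Hence `t m ≤ ‖v‖ t m / τ + o(t)`, that is, `τ ≤ ‖v‖`. -/

/-- The points of `A` that maximize over `A` a linear functional with positive maximum. -/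
def positivelySupportedSet (A : Set E) : Set E :=
  {v | v ∈ A ∧ ∃ w : E, 0 < inner ℝ v w ∧ ∀ x ∈ A, inner ℝ x w ≤ inner ℝ v w}

/-! ### Support functions of compact convex sets, and the end set -/

section SupportFunction

theorem inner_le_supportFunction {A : Set E} {v : E} (hv : v ∈ A) (w : E) :
    ((inner ℝ v w : ℝ) : EReal) ≤ supportFunction A w :=
  le_iSup₂ (f := fun x (_ : x ∈ A) => ((inner ℝ x w : ℝ) : EReal)) v hv

theorem supportFunction_eq {A : Set E} {v w : E} (hv : v ∈ A)
    (h : ∀ x ∈ A, inner ℝ x w ≤ inner ℝ v w) :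
    supportFunction A w = ((inner ℝ v w : ℝ) : EReal) :=
  le_antisymm (iSup₂_le fun x hx => EReal.coe_le_coe_iff.2 (h x hx))
    (inner_le_supportFunction hv w)

theorem exists_inner_max {A : Set E} (hA : IsCompact A) (hne : A.Nonempty) (w : E) :
    ∃ v ∈ A, ∀ x ∈ A, inner ℝ x w ≤ inner ℝ v w := by
  obtain ⟨v, hv, h⟩ := hA.exists_isMaxOn hne
    (f := fun x : E => (inner ℝ x w : ℝ)) (by fun_prop)
  exact ⟨v, hv, fun x hx => h hx⟩

theorem exists_proj {A : Set E} (hA : IsCompact A) (hne : A.Nonempty) (hc : Convex ℝ A) (y : E) :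
    ∃ p ∈ A, (∀ x ∈ A, inner ℝ x (y - p) ≤ inner ℝ p (y - p)) ∧ ∀ x ∈ A, ‖y - p‖ ≤ ‖y - x‖ := by
  obtain ⟨p, hp, h⟩ := exists_norm_eq_iInf_of_complete_convex hne hA.isComplete hc y
  refine ⟨p, hp, fun x hx => ?_, fun x hx => ?_⟩
  · have := (norm_eq_iInf_iff_real_inner_le_zero hc hp).1 h x hx
    rw [real_inner_comm, inner_sub_left] at this
    linarith
  · rw [h]
    exact ciInf_le (f := fun z : A => ‖y - z‖)
      ⟨0, by rintro _ ⟨z, rfl⟩; exact norm_nonneg _⟩ ⟨x, hx⟩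

/-- Separation: with `p` the projection of `v` on `A`, testing the functional `v - p` leaves `‖v -
p‖² ≤ 0`. -/
theorem mem_of_inner_le {A : Set E} (hA : IsCompact A) (hne : A.Nonempty) (hc : Convex ℝ A)
    {v : E} (h : ∀ z u, u ∈ A → (∀ x ∈ A, inner ℝ x z ≤ inner ℝ u z) →
      inner ℝ v z ≤ inner ℝ u z) : v ∈ A := by
  obtain ⟨p, hp, hmax, -⟩ := exists_proj hA hne hc v
  have h1 := h _ p hp hmax
  have h2 : inner ℝ (v - p) (v - p) ≤ 0 := by
    rw [inner_sub_left]; linarith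
  rw [real_inner_self_nonpos, sub_eq_zero] at h2
  rwa [h2]

theorem mem_regularSubdifferential_supportFunction {A : Set E} {v w : E} (hv : v ∈ A)
    (h : ∀ x ∈ A, inner ℝ x w ≤ inner ℝ v w) :
    v ∈ regularSubdifferential (supportFunction A) w := by
  have h0 := supportFunction_eq hv h
  refine ⟨by simp [IsFiniteAt, h0], fun ε hε => Eventually.of_forall fun y => ?_⟩
  refine le_trans ?_ (inner_le_supportFunction hv y)
  rw [h0, EReal.coe_le_coe_iff, EReal.toReal_coe, inner_sub_right]
  nlinarith [norm_nonneg (y - w)]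

theorem regularSubdifferential_subset_subdifferential (g : E → EReal) (x : E) :
    regularSubdifferential g x ⊆ subdifferential g x := fun v hv =>
  ⟨hv.1, fun _ => x, fun _ => v, tendsto_const_nhds, tendsto_const_nhds, fun _ => hv,
    tendsto_const_nhds⟩

/-- Regular subgradients bound difference quotients from below. -/
theorem eventually_le_of_mem_regularSubdifferential {g : E → EReal} {x v : E}
    (hv : v ∈ regularSubdifferential g x) (z : E) {ε : ℝ} (hε : 0 < ε) :
    ∀ᶠ t : ℝ in 𝓝[>] 0, (((g x).toReal + t * (inner ℝ v z - ε * ‖z‖) : ℝ) : EReal) ≤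
      g (x + t • z) := by
  have ht : Tendsto (fun t : ℝ => x + t • z) (𝓝[>] 0) (𝓝 x) := by
    have : Tendsto (fun t : ℝ => x + t • z) (𝓝 0) (𝓝 (x + (0 : ℝ) • z)) :=
      Continuous.tendsto (by fun_prop) 0
    rw [zero_smul, add_zero] at this
    exact this.mono_left nhdsWithin_le_nhds
  filter_upwards [ht.eventually (hv.2 ε hε), self_mem_nhdsWithin] with t h1 h2
  have h2 : 0 < t := h2
  refine le_trans (le_of_eq ?_) h1
  rw [add_sub_cancel_left, inner_smul_right, norm_smul, Real.norm_of_nonneg h2.le]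
  congr 1
  ring

/-- Sublinearity of the support function `σ`: in a direction `z` its difference quotient at `w` is
at most `σ(z)`, which puts `v` in `A` by separation; in the direction `-w` homogeneity gives the
quotient `-σ(w)`, which makes `v` a maximizer. -/
theorem regularSubdifferential_supportFunction_subset {A : Set E} (hA : IsCompact A)
    (hne : A.Nonempty) (hc : Convex ℝ A) (w : E) :
    regularSubdifferential (supportFunction A) w ⊆
      {v | v ∈ A ∧ ∀ x ∈ A, inner ℝ x w ≤ inner ℝ v w} := by
  intro v hv
  obtain ⟨m, hm, hmax⟩ := exists_inner_max hA hne w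
  have h0 := supportFunction_eq hm hmax
  have hvA : v ∈ A := by
    refine mem_of_inner_le hA hne hc fun z u hu hz => ?_
    refine le_of_forall_pos_le_add fun η hη => ?_
    have hε : 0 < η / (‖z‖ + 1) := by positivity
    obtain ⟨t, h1, h2⟩ := ((eventually_le_of_mem_regularSubdifferential hv z hε).and
      self_mem_nhdsWithin).exists
    have h2 : 0 < t := h2
    have h3 : supportFunction A (w + t • z) ≤ ((inner ℝ m w + t * inner ℝ u z : ℝ) : EReal) := by
      refine iSup₂_le fun x hx => EReal.coe_le_coe_iff.2 ?_
      rw [inner_add_right, inner_smul_right]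
      have := hmax x hx
      have := mul_le_mul_of_nonneg_left (hz x hx) h2.le
      linarith
    have h4 := h1.trans h3
    rw [h0, EReal.coe_le_coe_iff, EReal.toReal_coe] at h4
    have h5 : inner ℝ v z - η / (‖z‖ + 1) * ‖z‖ ≤ inner ℝ u z := by nlinarith
    have h6 : η / (‖z‖ + 1) * ‖z‖ ≤ η := by
      rw [div_mul_eq_mul_div, div_le_iff₀ (by positivity)]
      nlinarith
    linarith
  refine ⟨hvA, fun x hx => (hmax x hx).trans ?_⟩
  refine le_of_forall_pos_le_add fun η hη => ?_
  have hε : 0 < η / (‖w‖ + 1) := by positivity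
  have hlt : ∀ᶠ t : ℝ in 𝓝[>] 0, t < 1 := nhdsWithin_le_nhds (eventually_lt_nhds one_pos)
  obtain ⟨t, ⟨h1, h2⟩, h7⟩ := (((eventually_le_of_mem_regularSubdifferential hv (-w) hε).and
    self_mem_nhdsWithin).and hlt).exists
  have h2 : 0 < t := h2
  have h3 : supportFunction A (w + t • -w) ≤ (((1 - t) * inner ℝ m w : ℝ) : EReal) := by
    refine iSup₂_le fun x hx => EReal.coe_le_coe_iff.2 ?_
    rw [inner_add_right, inner_smul_right, inner_neg_right]
    have := mul_le_mul_of_nonneg_left (hmax x hx) (sub_nonneg.2 h7.le)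
    linarith
  have h4 := h1.trans h3
  rw [h0, EReal.coe_le_coe_iff, EReal.toReal_coe, inner_neg_right, norm_neg] at h4
  have h6 : η / (‖w‖ + 1) * ‖w‖ ≤ η := by
    rw [div_mul_eq_mul_div, div_le_iff₀ (by positivity)]
    nlinarith
  nlinarith

theorem subdifferential_supportFunction_subset {A : Set E} (hA : IsCompact A)
    (hne : A.Nonempty) (hc : Convex ℝ A) (w : E) :
    subdifferential (supportFunction A) w ⊆
      {v | v ∈ A ∧ ∀ x ∈ A, inner ℝ x w ≤ inner ℝ v w} := by
  rintro v ⟨-, y, u, hy, -, hu, huv⟩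
  have h k := regularSubdifferential_supportFunction_subset hA hne hc _ (hu k)
  exact ⟨hA.isClosed.mem_of_tendsto huv (Eventually.of_forall fun k => (h k).1), fun x hx =>
    le_of_tendsto_of_tendsto' (tendsto_const_nhds.inner hy) (huv.inner hy) fun k => (h k).2 x hx⟩

theorem supportFunction_zero {A : Set E} (hne : A.Nonempty) : supportFunction A 0 = 0 := by
  obtain ⟨v, hv⟩ := hne
  simpa using supportFunction_eq (w := 0) hv (by simp)

theorem nonempty_of_isFiniteAt_supportFunction {A : Set E} {w : E}
    (h : IsFiniteAt (supportFunction A) w) : A.Nonempty := by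
  by_contra hA
  rw [Set.not_nonempty_iff_eq_empty] at hA
  exact h.2 (by simp [supportFunction, hA])

/-- The support function vanishes at 0, so the requirement of larger values at the approximating
points says exactly that the maxima there are positive. -/
theorem outerLimitingSubdifferential_supportFunction_subset {A : Set E} (hA : IsCompact A)
    (hc : Convex ℝ A) :
    outerLimitingSubdifferential (supportFunction A) 0 ⊆ closure (positivelySupportedSet A) := by
  rintro v ⟨hfin, y, u, -, -, hpos, hu, huv⟩
  have hne := nonempty_of_isFiniteAt_supportFunction hfin
  refine mem_closure_of_tendsto huv (Eventually.of_forall fun k => ?_)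
  obtain ⟨h1, h2⟩ := subdifferential_supportFunction_subset hA hne hc _ (hu k)
  refine ⟨h1, y k, ?_, h2⟩
  have := hpos k
  rwa [supportFunction_zero hne, supportFunction_eq h1 h2, EReal.coe_pos] at this

/-- Scaling `w` down to 0 keeps the maximizer `v`, so a constant sequence of subgradients suffices.
-/
theorem positivelySupportedSet_subset_outerLimitingSubdifferential (A : Set E) :
    positivelySupportedSet A ⊆ outerLimitingSubdifferential (supportFunction A) 0 := by
  rintro v ⟨hv, w, hw, hmax⟩
  have h0 : supportFunction A 0 = 0 := supportFunction_zero ⟨v, hv⟩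
  have ht : Tendsto (fun k : ℕ => (1 / ((k : ℝ) + 1)) • w) atTop (𝓝 0) := by
    simpa using (tendsto_one_div_add_atTop_nhds_zero_nat (𝕜 := ℝ)).smul_const w
  have hmax' (k : ℕ) : ∀ x ∈ A, inner ℝ x ((1 / ((k : ℝ) + 1)) • w) ≤
      inner ℝ v ((1 / ((k : ℝ) + 1)) • w) := fun x hx => by
    rw [inner_smul_right, inner_smul_right]
    exact mul_le_mul_of_nonneg_left (hmax x hx) (by positivity)
  refine ⟨by simp [IsFiniteAt, h0], fun k : ℕ => (1 / ((k : ℝ) + 1)) • w, fun _ => v, ht, ?_,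
    fun k => ?_, fun k => ?_, tendsto_const_nhds⟩
  · have : Tendsto (fun k : ℕ => ((inner ℝ v ((1 / ((k : ℝ) + 1)) • w) : ℝ) : EReal)) atTop
        (𝓝 ((inner ℝ v (0 : E) : ℝ) : EReal)) :=
      (continuous_coe_real_ereal.tendsto _).comp (tendsto_const_nhds.inner ht)
    rw [h0]
    simp only [inner_zero_right, EReal.coe_zero] at this
    simpa only [supportFunction_eq hv (hmax' _)] using this
  · rw [h0, supportFunction_eq hv (hmax' k), EReal.coe_pos, inner_smul_right]
    positivity
  · exact regularSubdifferential_subset_subdifferential _ _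
      (mem_regularSubdifferential_supportFunction hv (hmax' k))

theorem positivelySupportedSet_subset_endSet {A : Set E} (hA : IsClosed A) :
    positivelySupportedSet A ⊆ endSet A := by
  rintro v ⟨hv, w, hw, hmax⟩
  refine ⟨subset_closure hv, fun t ht htv => ?_⟩
  rw [hA.closure_eq] at htv
  have := hmax _ htv
  rw [real_inner_smul_left] at this
  nlinarith

/-- For small `s > 0` the point `(1 + s) x` is outside `A`. Its projection `p` is close to `x` and
maximizes the functional `w = (1 + s) x - p`; from `⟨p, w⟩ < (1 + s) ⟨x, w⟩ ≤ (1 + s) ⟨p, w⟩` the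
maximum is positive. -/
theorem endSet_subset_closure_positivelySupportedSet {A : Set E} (hA : IsCompact A)
    (hc : Convex ℝ A) : endSet A ⊆ closure (positivelySupportedSet A) := by
  rintro x ⟨hx, hend⟩
  rw [hA.isClosed.closure_eq] at hx hend
  rw [Metric.mem_closure_iff]
  intro ε hε
  -- Chosen so that `2 s ‖x‖ < ε`; the distance from `x` to `p` is at most `2 s ‖x‖`.
  set s : ℝ := ε / (2 * ‖x‖ + 1) with hs
  have hs0 : 0 < s := by positivity
  obtain ⟨p, hp, hmax, hnear⟩ := exists_proj hA ⟨x, hx⟩ hc ((1 + s) • x)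
  have hw : (1 + s) • x - p ≠ 0 := fun h => hend (1 + s) (by linarith)
    (by rwa [sub_eq_zero.1 h])
  refine ⟨p, ⟨hp, _, ?_, hmax⟩, ?_⟩
  · have h1 := hmax x hx
    have h2 : 0 < inner ℝ ((1 + s) • x - p) ((1 + s) • x - p) := real_inner_self_pos.2 hw
    rw [inner_sub_left, real_inner_smul_left] at h2
    nlinarith
  · have h1 := hnear x hx
    have h2 : (1 + s) • x - x = s • x := by rw [add_smul, one_smul, add_sub_cancel_left]
    rw [h2, norm_smul, Real.norm_of_nonneg hs0.le] at h1
    have h3 : x - p = ((1 + s) • x - p) - s • x := by rw [add_smul, one_smul]; abel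
    have h4 : s * (2 * ‖x‖ + 1) = ε := by rw [hs]; field_simp
    rw [dist_eq_norm, h3]
    refine (norm_sub_le _ _).trans_lt ?_
    rw [norm_smul, Real.norm_of_nonneg hs0.le]
    linarith

theorem infEDist_outerLimitingSubdifferential_supportFunction {A : Set E} (hA : IsCompact A)
    (hc : Convex ℝ A) :
    Metric.infEDist 0 (outerLimitingSubdifferential (supportFunction A) 0) =
      Metric.infEDist 0 (positivelySupportedSet A) :=
  le_antisymm
    (Metric.infEDist_anti (positivelySupportedSet_subset_outerLimitingSubdifferential A))
    (by
      rw [← Metric.infEDist_closure]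
      exact Metric.infEDist_anti (outerLimitingSubdifferential_supportFunction_subset hA hc))

theorem infEDist_endSet {A : Set E} (hA : IsCompact A) (hc : Convex ℝ A) :
    Metric.infEDist 0 (endSet A) = Metric.infEDist 0 (positivelySupportedSet A) :=
  le_antisymm
    (Metric.infEDist_anti (positivelySupportedSet_subset_endSet hA.isClosed))
    (by
      rw [← Metric.infEDist_closure]
      exact Metric.infEDist_anti (endSet_subset_closure_positivelySupportedSet hA hc))

end SupportFunction

end

/-! ### Lipschitz continuity on a closed ball -/

section LipschitzBall

variable {E : Type*} [NormedAddCommGroup E]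

/-- `g` is finite and Lipschitz on the closed ball of radius `r` around `x`. -/
structure IsLipschitzBall (g : E → EReal) (x : E) (r : ℝ) (K : ℝ≥0) : Prop where
  pos : 0 < r
  finite : ∀ y ∈ Metric.closedBall x r, IsFiniteAt g y
  lipschitz : LipschitzOnWith K (fun y => (g y).toReal) (Metric.closedBall x r)

theorem IsLocallyLipschitzAt.exists_isLipschitzBall {g : E → EReal} {x : E}
    (h : IsLocallyLipschitzAt g x) : ∃ r K, IsLipschitzBall g x r K := by
  obtain ⟨K, U, hU, hfin, hK⟩ := h
  obtain ⟨r, hr, hsub⟩ := Metric.nhds_basis_closedBall.mem_iff.1 hU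
  exact ⟨r, K, hr, fun y hy => hfin y (hsub hy), hK.mono hsub⟩

namespace IsLipschitzBall

variable {g : E → EReal} {x : E} {r : ℝ} {K : ℝ≥0}

theorem coe_toReal (h : IsLipschitzBall g x r K) {y : E} (hy : y ∈ Metric.closedBall x r) :
    (((g y).toReal : ℝ) : EReal) = g y :=
  EReal.coe_toReal (h.finite y hy).1 (h.finite y hy).2

theorem self_mem (h : IsLipschitzBall g x r K) : x ∈ Metric.closedBall x r :=
  Metric.mem_closedBall_self h.pos.le

theorem toReal_sub_le (h : IsLipschitzBall g x r K) {y z : E} (hy : y ∈ Metric.closedBall x r)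
    (hz : z ∈ Metric.closedBall x r) : (g y).toReal - (g z).toReal ≤ K * ‖y - z‖ := by
  have := h.lipschitz.dist_le_mul y hy z hz
  rw [Real.dist_eq, dist_eq_norm] at this
  exact (le_abs_self _).trans this

theorem closedBall_mem_nhds (h : IsLipschitzBall g x r K) : Metric.closedBall x r ∈ 𝓝 x :=
  Metric.closedBall_mem_nhds x h.pos

theorem tendsto (h : IsLipschitzBall g x r K) : Tendsto g (𝓝 x) (𝓝 (g x)) := by
  have h1 : ContinuousAt (fun y => (g y).toReal) x :=
    h.lipschitz.continuousOn.continuousAt h.closedBall_mem_nhds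
  have h2 := (continuous_coe_real_ereal.tendsto _).comp h1.tendsto
  rw [h.coe_toReal h.self_mem] at h2
  refine h2.congr' ?_
  filter_upwards [h.closedBall_mem_nhds] with y hy
  exact h.coe_toReal hy

theorem eventually_mem_ball (h : IsLipschitzBall g x r K) {y : ℕ → E}
    (hy : Tendsto y atTop (𝓝 x)) : ∀ᶠ k in atTop, y k ∈ Metric.ball x r :=
  hy.eventually (Metric.ball_mem_nhds x h.pos)

end IsLipschitzBall

end LipschitzBall

section

variable {E : Type*} [NormedAddCommGroup E] [InnerProductSpace ℝ E]

/-! ### Subgradients of Lipschitz functions and a mean value inequality -/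

section Subgradients

/-- Fermat's rule for the sum of `g` and a differentiable function. -/
theorem neg_mem_regularSubdifferential_of_isLocalMin_add [CompleteSpace E] {g : E → EReal}
    {x v : E} {q : E → ℝ} (hfin : IsFiniteAt g x) (hq : HasGradientAt q v x)
    (hmin : ∀ᶠ y in 𝓝 x, (((g x).toReal + q x - q y : ℝ) : EReal) ≤ g y) :
    -v ∈ regularSubdifferential g x := by
  refine ⟨hfin, fun ε hε => ?_⟩
  have h := (hasGradientAt_iff_isLittleO.1 hq).def hε
  filter_upwards [h, hmin] with y h1 h2
  refine le_trans (EReal.coe_le_coe_iff.2 ?_) h2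
  rw [Real.norm_eq_abs, abs_le] at h1
  rw [inner_neg_left]
  linarith [h1.2]

namespace IsLipschitzBall

variable {g : E → EReal} {x : E} {r : ℝ} {K : ℝ≥0}

theorem norm_le_of_mem_regularSubdifferential (h : IsLipschitzBall g x r K) {y v : E}
    (hy : y ∈ Metric.ball x r) (hv : v ∈ regularSubdifferential g y) : ‖v‖ ≤ K := by
  rcases eq_or_ne v 0 with rfl | hv0
  · simp
  have hvp : 0 < ‖v‖ := norm_pos_iff.2 hv0
  refine le_of_forall_pos_le_add fun ε hε => ?_
  have ht : Tendsto (fun t : ℝ => y + t • v) (𝓝[>] 0) (𝓝 y) := by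
    have : Tendsto (fun t : ℝ => y + t • v) (𝓝 0) (𝓝 (y + (0 : ℝ) • v)) :=
      Continuous.tendsto (by fun_prop) 0
    rw [zero_smul, add_zero] at this
    exact this.mono_left nhdsWithin_le_nhds
  obtain ⟨t, ⟨h1, h2⟩, h3⟩ := (((eventually_le_of_mem_regularSubdifferential hv v hε).and
    self_mem_nhdsWithin).and (ht.eventually (Metric.isOpen_ball.mem_nhds hy))).exists
  have h2 : 0 < t := h2
  have hz := Metric.ball_subset_closedBall h3
  rw [← h.coe_toReal hz, EReal.coe_le_coe_iff] at h1
  have h4 := h.toReal_sub_le hz (Metric.ball_subset_closedBall hy)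
  rw [add_sub_cancel_left, norm_smul, Real.norm_of_nonneg h2.le] at h4
  rw [real_inner_self_eq_norm_sq] at h1
  have h5 : t * ‖v‖ * ‖v‖ ≤ t * ‖v‖ * (K + ε) := by nlinarith
  exact le_of_mul_le_mul_left h5 (by positivity)

/-- Bounded sequences of subgradients have cluster points in the limiting subdifferential. -/
theorem exists_subseq_tendsto [ProperSpace E] (h : IsLipschitzBall g x r K) {y u : ℕ → E}
    (hy : Tendsto y atTop (𝓝 x)) (hu : ∀ k, u k ∈ regularSubdifferential g (y k)) :
    ∃ v ∈ subdifferential g x, ∃ θ : ℕ → ℕ, StrictMono θ ∧ Tendsto (u ∘ θ) atTop (𝓝 v) := by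
  have hb : ∃ᶠ k in atTop, u k ∈ Metric.closedBall (0 : E) K :=
    ((h.eventually_mem_ball hy).mono fun k hk => by
      simpa using h.norm_le_of_mem_regularSubdifferential hk (hu k)).frequently
  obtain ⟨v, -, θ, hθ, hlim⟩ :=
    tendsto_subseq_of_frequently_bounded Metric.isBounded_closedBall hb
  exact ⟨v, ⟨h.finite x h.self_mem, y ∘ θ, u ∘ θ, hy.comp hθ.tendsto_atTop,
    h.tendsto.comp (hy.comp hθ.tendsto_atTop), fun k => hu _, hlim⟩, θ, hθ, hlim⟩

/-- An approximate mean value theorem. -/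
theorem exists_regularSubgradient_le_inner [ProperSpace E] (h : IsLipschitzBall g x r K) {w : E}
    {t c : ℝ} (ht : 0 < t) (htw : t * ‖w‖ < r / 2)
    (hc : (g x).toReal + t * c < (g (x + t • w)).toReal) {δ : ℝ} (hδ : 0 < δ) :
    ∃ y v, v ∈ regularSubdifferential g y ∧ ‖y - x‖ ≤ t * ‖w‖ + δ ∧ c ≤ inner ℝ v w := by
  have hr := h.pos
  set f : E → ℝ := fun y => (g y).toReal with hf
  set a : ℝ := f (x + t • w) - f x - t * c with ha
  have ha0 : 0 < a := by rw [ha]; simp only [hf]; linarith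
  obtain ⟨M, hM0, hM1, hM2, hM3⟩ : ∃ M : ℝ, 0 < M ∧ (K : ℝ) ^ 2 < 4 * M * a ∧
      (K : ℝ) < M * (r / 2) ∧ (K : ℝ) < M * δ := by
    -- One pair of terms per inequality; the terms with numerator 1 keep the inequalities strict
    -- when `K = 0`.
    refine ⟨(K : ℝ) ^ 2 / a + K / (r / 2) + K / δ + 1 / a + 1 / (r / 2) + 1 / δ,
      by positivity, ?_, ?_, ?_⟩
    · have : 0 ≤ (K / (r / 2) + K / δ + 1 / (r / 2) + 1 / δ) * a := by positivity
      have e : ((K : ℝ) ^ 2 / a + K / (r / 2) + K / δ + 1 / a + 1 / (r / 2) + 1 / δ) * a =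
        K ^ 2 + 1 + (K / (r / 2) + K / δ + 1 / (r / 2) + 1 / δ) * a := by field_simp; ring
      nlinarith [sq_nonneg (K : ℝ)]
    · have : 0 ≤ ((K : ℝ) ^ 2 / a + K / δ + 1 / a + 1 / δ) * (r / 2) := by positivity
      have e : ((K : ℝ) ^ 2 / a + K / (r / 2) + K / δ + 1 / a + 1 / (r / 2) + 1 / δ) * (r / 2) =
        K + 1 + ((K : ℝ) ^ 2 / a + K / δ + 1 / a + 1 / δ) * (r / 2) := by field_simp; ring
      linarith
    · have : 0 ≤ ((K : ℝ) ^ 2 / a + K / (r / 2) + 1 / a + 1 / (r / 2)) * δ := by positivity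
      have e : ((K : ℝ) ^ 2 / a + K / (r / 2) + K / δ + 1 / a + 1 / (r / 2) + 1 / δ) * δ =
        K + 1 + ((K : ℝ) ^ 2 / a + K / (r / 2) + 1 / a + 1 / (r / 2)) * δ := by
          field_simp; ring
      linarith
  have hseg {s : ℝ} (hs : s ∈ Set.Icc 0 t) : ‖s • w‖ < r / 2 := by
    rw [norm_smul, Real.norm_of_nonneg hs.1]
    exact (mul_le_mul_of_nonneg_right hs.2 (norm_nonneg w)).trans_lt htw
  have hsegb {s : ℝ} (hs : s ∈ Set.Icc 0 t) : x + s • w ∈ Metric.closedBall x r := by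
    rw [mem_closedBall_iff_norm, add_sub_cancel_left]
    linarith [hseg hs]
  have hcomp : IsCompact (Set.Icc 0 t ×ˢ Metric.closedBall x r) :=
    isCompact_Icc.prod (isCompact_closedBall x r)
  -- The point `y` is tied to `x + s w` only by a quadratic penalty. Minimality in `y` will produce
  -- the subgradient, and minimality in `s` its pairing with `w`.
  have hcont : ContinuousOn (fun p : ℝ × E => f p.2 - c * p.1 + M * ‖p.2 - x - p.1 • w‖ ^ 2)
      (Set.Icc 0 t ×ˢ Metric.closedBall x r) := by
    have h1 : ContinuousOn (fun p : ℝ × E => f p.2) (Set.Icc 0 t ×ˢ Metric.closedBall x r) :=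
      h.lipschitz.continuousOn.comp continuousOn_snd fun p hp => hp.2
    exact (h1.sub (by fun_prop)).add (by fun_prop)
  obtain ⟨⟨s, y⟩, ⟨hs, hy⟩, hmin⟩ := hcomp.exists_isMinOn
    ⟨(0, x), ⟨⟨le_rfl, ht.le⟩, h.self_mem⟩⟩ hcont
  have hmin' : ∀ s' ∈ Set.Icc 0 t, ∀ y' ∈ Metric.closedBall x r,
      f y - c * s + M * ‖y - x - s • w‖ ^ 2 ≤ f y' - c * s' + M * ‖y' - x - s' • w‖ ^ 2 :=
    fun s' hs' y' hy' => hmin (a := (s', y')) ⟨hs', hy'⟩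
  clear_value a
  clear hmin hcont hcomp
  simp only at hs hy
  set d : ℝ := ‖y - x - s • w‖ with hd
  have hd0 : 0 ≤ d := norm_nonneg _
  have hLip : f (x + s • w) - f y ≤ K * d := by
    have := h.toReal_sub_le (hsegb hs) hy
    rwa [norm_sub_rev, ← sub_sub] at this
  have hdK : M * d ≤ K := by
    have := hmin' s hs _ (hsegb hs)
    rw [add_sub_cancel_left, sub_self, norm_zero] at this
    rcases hd0.eq_or_lt with h0 | h0
    · rw [← h0, mul_zero]; exact K.2
    · exact le_of_mul_le_mul_right (by nlinarith) h0
  have hyx : ‖y - x‖ ≤ d + ‖s • w‖ := by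
    have := norm_add_le (y - x - s • w) (s • w)
    rwa [sub_add_cancel] at this
  have hyball : y ∈ Metric.ball x r := by
    rw [mem_ball_iff_norm]
    have : d < r / 2 := lt_of_mul_lt_mul_left (hdK.trans_lt hM2) hM0.le
    linarith [hseg hs]
  -- If `s = t`, comparison with `(0, x)` gives `a ≤ K d - M d² ≤ K² / (4M) < a`.
  have hst : s < t := by
    refine lt_of_le_of_ne hs.2 fun hst => ?_
    have h1 := hmin' 0 ⟨le_rfl, ht.le⟩ x h.self_mem
    rw [sub_self, zero_smul, sub_self, norm_zero] at h1
    rw [hst] at h1 hLip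
    have h2 : a ≤ K * d - M * d ^ 2 := by rw [ha]; linarith
    nlinarith [sq_nonneg (2 * M * d - K)]
  refine ⟨y, -((2 * M) • (y - x - s • w)), ?_, ?_, ?_⟩
  · have hq : HasGradientAt (fun z => M * ‖z - x - s • w‖ ^ 2)
        ((2 * M) • (y - x - s • w)) y := by
      rw [hasGradientAt_iff_hasFDerivAt]
      have h1 : HasFDerivAt (fun z : E => z - x - s • w) (ContinuousLinearMap.id ℝ E) y :=
        ((hasFDerivAt_id y).sub_const x).sub_const _
      refine (h1.norm_sq.const_mul M).congr_fderiv ?_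
      ext z
      simp
      ring
    refine neg_mem_regularSubdifferential_of_isLocalMin_add (h.finite y hy) hq ?_
    filter_upwards [Metric.isOpen_ball.mem_nhds hyball] with z hz
    have hz' := Metric.ball_subset_closedBall hz
    rw [← h.coe_toReal hz', EReal.coe_le_coe_iff]
    linarith [hmin' s hs z hz']
  · refine hyx.trans ?_
    have h1 : d < δ := lt_of_mul_lt_mul_left (hdK.trans_lt hM3) hM0.le
    have h2 : ‖s • w‖ ≤ t * ‖w‖ := by
      rw [norm_smul, Real.norm_of_nonneg hs.1]
      exact mul_le_mul_of_nonneg_right hs.2 (norm_nonneg w)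
    linarith
  · rw [inner_neg_left, real_inner_smul_left]
    -- Only increases of `s` are tested, since the minimum may be at `s = 0`; this one-sided
    -- condition gives the required sign.
    have key : ∀ e : ℝ, 0 < e → e ≤ t - s →
        2 * M * inner ℝ (y - x - s • w) w + c ≤ e * (M * ‖w‖ ^ 2) := by
      intro e he hes
      have h1 := hmin' (s + e) ⟨by linarith [hs.1], by linarith⟩ y hy
      have h2 : y - x - (s + e) • w = (y - x - s • w) - e • w := by rw [add_smul]; abel
      rw [h2, norm_sub_sq_real (y - x - s • w), inner_smul_right, norm_smul, Real.norm_of_nonneg he.le,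
        ← hd] at h1
      refine le_of_mul_le_mul_left ?_ he
      nlinarith
    have hlim : Tendsto (fun e : ℝ => e * (M * ‖w‖ ^ 2)) (𝓝[>] 0) (𝓝 0) := by
      have : Tendsto (fun e : ℝ => e * (M * ‖w‖ ^ 2)) (𝓝 0) (𝓝 (0 * (M * ‖w‖ ^ 2))) :=
        Continuous.tendsto (by fun_prop) 0
      rw [zero_mul] at this
      exact this.mono_left nhdsWithin_le_nhds
    have hle : ∀ᶠ e : ℝ in 𝓝[>] 0, 2 * M * inner ℝ (y - x - s • w) w + c ≤ e * (M * ‖w‖ ^ 2) := by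
      filter_upwards [self_mem_nhdsWithin,
        nhdsWithin_le_nhds (eventually_lt_nhds (sub_pos.2 hst))] with e he he'
      exact key e he he'.le
    linarith [ge_of_tendsto hlim hle]

/-- Upper difference quotients are dominated by the limiting subdifferential. -/
theorem eventually_toReal_le [ProperSpace E] (h : IsLipschitzBall g x r K) {w : E} {c : ℝ}
    (hc : ∀ v ∈ subdifferential g x, inner ℝ v w < c) :
    ∀ᶠ t : ℝ in 𝓝[>] 0, (g (x + t • w)).toReal ≤ (g x).toReal + t * c := by
  by_contra hcon
  have hr := h.pos
  have key : ∀ k : ℕ, ∃ y v, v ∈ regularSubdifferential g y ∧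
      ‖y - x‖ ≤ 2 * (1 / ((k : ℝ) + 1)) ∧ c ≤ inner ℝ v w := by
    intro k
    have hk : 0 < 1 / ((k : ℝ) + 1) := by positivity
    have hlim : Tendsto (fun t : ℝ => t * ‖w‖) (𝓝[>] 0) (𝓝 0) := by
      have : Tendsto (fun t : ℝ => t * ‖w‖) (𝓝 0) (𝓝 (0 * ‖w‖)) :=
        Continuous.tendsto (by fun_prop) 0
      rw [zero_mul] at this
      exact this.mono_left nhdsWithin_le_nhds
    have hsmall : ∀ᶠ t : ℝ in 𝓝[>] 0, 0 < t ∧ t * ‖w‖ < r / 2 ∧ t * ‖w‖ < 1 / ((k : ℝ) + 1) := by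
      filter_upwards [self_mem_nhdsWithin, hlim.eventually (gt_mem_nhds (half_pos hr)),
        hlim.eventually (gt_mem_nhds hk)] with t h1 h2 h3
      exact ⟨h1, h2, h3⟩
    obtain ⟨t, h1, h2, h3, h4⟩ := ((not_eventually.1 hcon).and_eventually hsmall).exists
    obtain ⟨y, v, hv, hy, hvw⟩ := h.exists_regularSubgradient_le_inner h2 h3 (not_le.1 h1) hk
    exact ⟨y, v, hv, by linarith, hvw⟩
  choose y u hu hy hw using key
  have hyx : Tendsto y atTop (𝓝 x) := by
    rw [tendsto_iff_norm_sub_tendsto_zero]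
    refine squeeze_zero (fun k => norm_nonneg _) hy ?_
    simpa using (tendsto_one_div_add_atTop_nhds_zero_nat (𝕜 := ℝ)).const_mul 2
  obtain ⟨v, hv, θ, -, hlim⟩ := h.exists_subseq_tendsto hyx hu
  exact (hc v hv).not_ge (ge_of_tendsto' (hlim.inner tendsto_const_nhds) fun k => hw (θ k))

end IsLipschitzBall

end Subgradients

end

/-! ### The level set and its boundary -/

section LevelSet

variable {E : Type*} [NormedAddCommGroup E]

theorem coe_mul_infEDist {s : Set E} (hs : s.Nonempty)
    (τ : ℝ≥0) (y : E) :
    (((τ : ℝ≥0∞) * Metric.infEDist y s : ℝ≥0∞) : EReal) =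
      ((τ * Metric.infDist y s : ℝ) : EReal) := by
  have h : (τ : ℝ≥0∞) * Metric.infEDist y s = ENNReal.ofReal (τ * Metric.infDist y s) := by
    rw [ENNReal.ofReal_mul τ.coe_nonneg, ENNReal.ofReal_coe_nnreal, Metric.infDist,
      ENNReal.ofReal_toReal (Metric.infEDist_ne_top hs)]
  rw [h, EReal.coe_ennreal_ofReal, max_eq_left (mul_nonneg τ.coe_nonneg Metric.infDist_nonneg)]

/-- By continuity a nonzero value would keep its sign nearby, placing `x` in the exterior or the
interior. -/
theorem eq_zero_of_mem_frontier_levelSet {g : E → EReal} {x : E} (hg : Tendsto g (𝓝 x) (𝓝 (g x)))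
    (hx : x ∈ frontier (levelSet g)) : g x = 0 := by
  refine le_antisymm ?_ ?_
  · refine not_lt.1 fun h => ?_
    obtain ⟨y, h1, h2⟩ := ((mem_closure_iff_frequently.1 hx.1).and_eventually
      (hg.eventually (lt_mem_nhds h))).exists
    exact not_lt.2 h1 h2
  · refine not_lt.1 fun h => hx.2 ?_
    rw [mem_interior_iff_mem_nhds]
    filter_upwards [hg.eventually (gt_mem_nhds h)] with y hy using hy.le

end LevelSet

section

variable {E : Type*} [NormedAddCommGroup E] [InnerProductSpace ℝ E]

/-! ### Epigraph normals, and the effect of regularity on subgradients -/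

section Regularity

theorem toLp_mem_regularNormalCone_epigraph {g : E → EReal} {y v : E}
    (hv : v ∈ regularSubdifferential g y) :
    WithLp.toLp 2 (v, (-1 : ℝ)) ∈
      regularNormalCone (epigraph g) (WithLp.toLp 2 (y, (g y).toReal)) := by
  rintro p ⟨t, u, ht, ht0, hu, hmem⟩
  have hfst : Tendsto (fun k => (u k).fst) atTop (𝓝 p.fst) :=
    ((WithLp.prod_continuous_ofLp 2 E ℝ).fst.tendsto p).comp hu
  have hsnd : Tendsto (fun k => (u k).snd) atTop (𝓝 p.snd) :=
    ((WithLp.prod_continuous_ofLp 2 E ℝ).snd.tendsto p).comp hu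
  have hz : Tendsto (fun k => y + t k • (u k).fst) atTop (𝓝 y) := by
    simpa using (ht0.smul hfst).const_add y
  have key : ∀ ε : ℝ, 0 < ε → inner ℝ v p.fst - ε * ‖p.fst‖ ≤ p.snd := by
    intro ε hε
    refine le_of_tendsto_of_tendsto ((tendsto_const_nhds.inner hfst).sub
      (hfst.norm.const_mul ε)) hsnd ?_
    filter_upwards [hz.eventually (hv.2 ε hε)] with k hk
    have h1 := hk.trans (hmem k)
    rw [EReal.coe_le_coe_iff, add_sub_cancel_left, inner_smul_right, norm_smul,
      Real.norm_of_nonneg (ht k).le] at h1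
    simp only [WithLp.add_snd, WithLp.smul_snd, smul_eq_mul] at h1
    change _ ≤ (g y).toReal + t k * (u k).snd at h1
    exact le_of_mul_le_mul_left (by linarith) (ht k)
  have hlim : Tendsto (fun ε : ℝ => inner ℝ v p.fst - ε * ‖p.fst‖) (𝓝[>] 0)
      (𝓝 (inner ℝ v p.fst - 0 * ‖p.fst‖)) :=
    (Continuous.tendsto (by fun_prop) 0).mono_left nhdsWithin_le_nhds
  have h := le_of_tendsto hlim (by filter_upwards [self_mem_nhdsWithin] with ε hε using key ε hε)
  rw [WithLp.prod_inner_apply]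
  simp
  linarith

/-- If the inequality failed along `y k → x`, a cluster point `w'` of the unit directions from `x`
to `y k` would give the tangent vector `(w', ⟨v, w'⟩ - ε)` to the epigraph, whose pairing with `(v,
-1)` is `ε > 0`. -/
theorem mem_regularSubdifferential_of_toLp_mem [ProperSpace E] {g : E → EReal} {x v : E}
    (hfin : IsFiniteAt g x)
    (hv : WithLp.toLp 2 (v, (-1 : ℝ)) ∈
      regularNormalCone (epigraph g) (WithLp.toLp 2 (x, (g x).toReal))) :
    v ∈ regularSubdifferential g x := by
  refine ⟨hfin, fun ε hε => ?_⟩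
  by_contra hcon
  obtain ⟨y, hy, hlt⟩ := exists_seq_forall_of_frequently (not_eventually.1 hcon)
  have hne (k : ℕ) : 0 < ‖y k - x‖ := by
    rw [norm_pos_iff, sub_ne_zero]
    intro h
    apply hlt k
    simp [h, EReal.coe_toReal hfin.1 hfin.2]
  set w : ℕ → E := fun k => ‖y k - x‖⁻¹ • (y k - x) with hw
  have hwn (k : ℕ) : ‖w k‖ = 1 := by
    rw [hw]; simp only
    rw [norm_smul, norm_inv, norm_norm, inv_mul_cancel₀ (hne k).ne']
  have hyw (k : ℕ) : ‖y k - x‖ • w k = y k - x := by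
    rw [hw]; simp only
    rw [smul_inv_smul₀ (hne k).ne']
  obtain ⟨w', -, θ, hθ, hlim⟩ := tendsto_subseq_of_bounded
    (Metric.isBounded_closedBall (x := (0 : E)) (r := 1)) (x := w) (fun k => by simp [hwn])
  have hmem : WithLp.toLp 2 (w', inner ℝ v w' - ε) ∈
      tangentCone (epigraph g) (WithLp.toLp 2 (x, (g x).toReal)) := by
    refine ⟨fun k => ‖y (θ k) - x‖,
      fun k => WithLp.toLp 2 (w (θ k), inner ℝ v (w (θ k)) - ε), fun k => hne _, ?_, ?_, fun k => ?_⟩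
    · exact (tendsto_iff_norm_sub_tendsto_zero.1 hy).comp hθ.tendsto_atTop
    · exact ((WithLp.prod_continuous_toLp 2 E ℝ).tendsto _).comp
        (hlim.prodMk_nhds ((tendsto_const_nhds.inner hlim).sub_const ε))
    · have h1 := (not_le.1 (hlt (θ k))).le
      have h2 : ‖y (θ k) - x‖ * (inner ℝ v (w (θ k)) - ε) =
          inner ℝ v (y (θ k) - x) - ε * ‖y (θ k) - x‖ := by
        have h3 : inner ℝ v (y (θ k) - x) = ‖y (θ k) - x‖ * inner ℝ v (w (θ k)) := by
          rw [← inner_smul_right, hyw]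
        rw [h3]; ring
      have h3 : x + ‖y (θ k) - x‖ • w (θ k) = y (θ k) := by rw [hyw]; abel
      change g (x + ‖y (θ k) - x‖ • w (θ k)) ≤
        (((g x).toReal + ‖y (θ k) - x‖ * (inner ℝ v (w (θ k)) - ε) : ℝ) : EReal)
      rw [h2, h3, ← add_sub_assoc]
      exact h1
  have := hv _ hmem
  rw [WithLp.prod_inner_apply] at this
  simp at this
  linarith

/-- Regular subgradients `u k` become regular normals `(u k, -1)`; their limit is a normal, hence by
regularity of the epigraph a regular normal, which translates back. -/
theorem IsRegularAt.subdifferential_eq [ProperSpace E] {g : E → EReal} {x : E}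
    (hreg : IsRegularAt g x) : subdifferential g x = regularSubdifferential g x := by
  refine Set.Subset.antisymm ?_ (regularSubdifferential_subset_subdifferential g x)
  obtain ⟨hfin, -, hN⟩ := hreg
  rintro v ⟨-, y, u, hy, hgy, hu, hlim⟩
  refine mem_regularSubdifferential_of_toLp_mem hfin ?_
  rw [hN]
  refine ⟨fun k => WithLp.toLp 2 (y k, (g (y k)).toReal),
    fun k => WithLp.toLp 2 (u k, (-1 : ℝ)), fun k => ?_, ?_,
    fun k => toLp_mem_regularNormalCone_epigraph (hu k), ?_⟩
  · change g (y k) ≤ (((g (y k)).toReal : ℝ) : EReal)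
    rw [EReal.coe_toReal (hu k).1.1 (hu k).1.2]
  · exact ((WithLp.prod_continuous_toLp 2 E ℝ).tendsto _).comp
      (hy.prodMk_nhds ((EReal.tendsto_toReal hfin.1 hfin.2).comp hgy))
  · exact ((WithLp.prod_continuous_toLp 2 E ℝ).tendsto _).comp
      (hlim.prodMk_nhds tendsto_const_nhds)

/-- At each `y` the convex combination is dominated by whichever of the two subgradients pairs
larger with `y - x`. -/
theorem convex_regularSubdifferential (g : E → EReal) (x : E) :
    Convex ℝ (regularSubdifferential g x) := by
  intro u hu v hv a b ha hb hab
  refine ⟨hu.1, fun ε hε => ?_⟩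
  filter_upwards [hu.2 ε hε, hv.2 ε hε] with y h1 h2
  rcases le_total (inner ℝ u (y - x)) (inner ℝ v (y - x)) with h | h
  · refine le_trans (EReal.coe_le_coe_iff.2 ?_) h2
    rw [inner_add_left, real_inner_smul_left, real_inner_smul_left]
    have : a = 1 - b := by linarith
    subst this
    nlinarith
  · refine le_trans (EReal.coe_le_coe_iff.2 ?_) h1
    rw [inner_add_left, real_inner_smul_left, real_inner_smul_left]
    have : b = 1 - a := by linarith
    subst this
    nlinarith

theorem isClosed_regularSubdifferential (g : E → EReal) (x : E) :
    IsClosed (regularSubdifferential g x) := by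
  refine isClosed_of_closure_subset fun v hv => ?_
  rw [Metric.mem_closure_iff] at hv
  obtain ⟨u₀, hu₀, -⟩ := hv 1 one_pos
  refine ⟨hu₀.1, fun ε hε => ?_⟩
  obtain ⟨u, hu, huv⟩ := hv (ε / 2) (half_pos hε)
  filter_upwards [hu.2 (ε / 2) (half_pos hε)] with y hy
  refine le_trans (EReal.coe_le_coe_iff.2 ?_) hy
  rw [dist_eq_norm] at huv
  have h1 := real_inner_le_norm (v - u) (y - x)
  rw [inner_sub_left] at h1
  nlinarith [norm_nonneg (y - x)]

theorem IsLipschitzBall.isCompact_regularSubdifferential [ProperSpace E] {g : E → EReal} {x : E}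
    {r : ℝ} {K : ℝ≥0} (h : IsLipschitzBall g x r K) :
    IsCompact (regularSubdifferential g x) :=
  (isCompact_closedBall (0 : E) K).of_isClosed_subset (isClosed_regularSubdifferential g x)
    fun v hv => by
      simpa using h.norm_le_of_mem_regularSubdifferential (Metric.mem_ball_self h.pos) hv

end Regularity

/-! ### The two bounds on the error bound modulus -/

section Modulus

namespace IsLipschitzBall

variable {g : E → EReal} {x : E} {r : ℝ} {K : ℝ≥0}

/-- Where the error bound with constant `τ` fails, there is a nearby regular subgradient of norm
at most `τ` outside of the level set. -/
theorem exists_regularSubgradient_norm_le [ProperSpace E] (h : IsLipschitzBall g x r K)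
    (h0 : g x = 0) {τ : ℝ} (hτ : 0 < τ) {z : E} (hz : ‖z - x‖ < r / 2)
    (hlt : max (g z).toReal 0 < τ * Metric.infDist z (levelSet g)) :
    ∃ y v, v ∈ regularSubdifferential g y ∧ 0 < g y ∧ ‖y - x‖ ≤ 2 * ‖z - x‖ ∧ ‖v‖ ≤ τ := by
  have hr := h.pos
  set f : E → ℝ := fun y => (g y).toReal with hf
  set d := Metric.infDist z (levelSet g) with hd
  have hdx : d ≤ ‖z - x‖ := by
    rw [← dist_eq_norm]
    exact Metric.infDist_le_dist_of_mem (le_of_eq h0)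
  -- `δ` smooths the norm at `z`; it uses up only half of the slack in the failed error bound.
  obtain ⟨δ, hδ, hδd⟩ : ∃ δ : ℝ, 0 < δ ∧ max (f z) 0 + τ * δ < τ * d := by
    refine ⟨(τ * d - max (f z) 0) / (2 * τ), div_pos (sub_pos.2 hlt) (by positivity), ?_⟩
    have : τ * ((τ * d - max (f z) 0) / (2 * τ)) = (τ * d - max (f z) 0) / 2 := by field_simp
    rw [this]
    change max (f z) 0 < τ * d at hlt
    linarith
  have hzb : z ∈ Metric.closedBall x r := by rw [mem_closedBall_iff_norm]; linarith
  have hcont : ContinuousOn (fun y => max (f y) 0 + τ * √(‖y - z‖ ^ 2 + δ ^ 2))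
      (Metric.closedBall x r) :=
    (h.lipschitz.continuousOn.sup continuousOn_const).add (by fun_prop)
  obtain ⟨y, hy, hmin⟩ := (isCompact_closedBall x r).exists_isMinOn ⟨z, hzb⟩ hcont
  have hmin' : ∀ y' ∈ Metric.closedBall x r, max (f y) 0 + τ * √(‖y - z‖ ^ 2 + δ ^ 2) ≤
      max (f y') 0 + τ * √(‖y' - z‖ ^ 2 + δ ^ 2) := fun y' hy' => hmin hy'
  set S := √(‖y - z‖ ^ 2 + δ ^ 2) with hS
  have hS0 : 0 < S := Real.sqrt_pos.2 (by positivity)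
  have hyS : ‖y - z‖ ≤ S := Real.le_sqrt_of_sq_le (by linarith [sq_nonneg δ])
  -- Comparison with `z` itself puts the minimizer closer to `z` than the level set, hence outside
  -- it.
  have hSd : S < d := by
    have h1 := hmin' z hzb
    rw [sub_self, norm_zero, zero_pow two_ne_zero, zero_add, Real.sqrt_sq hδ.le] at h1
    refine lt_of_mul_lt_mul_left ?_ hτ.le
    linarith [le_max_right (f y) 0]
  have hpos : 0 < g y := by
    refine not_le.1 fun hle => ?_
    have := Metric.infDist_le_dist_of_mem (x := z) (s := levelSet g) hle
    rw [dist_comm, dist_eq_norm] at this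
    linarith
  have hyx : ‖y - x‖ ≤ 2 * ‖z - x‖ := by
    have := norm_add_le (y - z) (z - x)
    rw [sub_add_sub_cancel] at this
    linarith
  have hyball : y ∈ Metric.ball x r := by rw [mem_ball_iff_norm]; linarith
  have hfpos : 0 < f y := by
    have := h.coe_toReal hy
    rwa [← this, EReal.coe_pos] at hpos
  refine ⟨y, -((τ / S) • (y - z)), ?_, hpos, hyx, ?_⟩
  · have hq : HasGradientAt (fun y' => τ * √(‖y' - z‖ ^ 2 + δ ^ 2)) ((τ / S) • (y - z)) y := by
      rw [hasGradientAt_iff_hasFDerivAt]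
      have h1 : HasFDerivAt (fun y' : E => y' - z) (ContinuousLinearMap.id ℝ E) y :=
        (hasFDerivAt_id y).sub_const z
      have h2 := ((h1.norm_sq.add_const (δ ^ 2)).sqrt (by positivity)).const_mul τ
      refine h2.congr_fderiv ?_
      ext e
      simp [← hS]
      field_simp
    have hfc : ContinuousAt f y :=
      h.lipschitz.continuousOn.continuousAt
        (mem_of_superset (Metric.isOpen_ball.mem_nhds hyball) Metric.ball_subset_closedBall)
    refine neg_mem_regularSubdifferential_of_isLocalMin_add (h.finite y hy) hq ?_
    -- Near `y` the function is positive, so the truncation at 0 can be dropped before applying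
    -- Fermat's rule.
    filter_upwards [Metric.isOpen_ball.mem_nhds hyball, hfc.eventually (lt_mem_nhds hfpos)]
      with e he hfe
    have he' := Metric.ball_subset_closedBall he
    rw [← h.coe_toReal he', EReal.coe_le_coe_iff]
    have := hmin' e he'
    rw [max_eq_left hfpos.le, max_eq_left hfe.le] at this
    linarith
  · rw [norm_neg, norm_smul, norm_div, Real.norm_of_nonneg hτ.le, Real.norm_of_nonneg hS0.le,
      div_mul_eq_mul_div, div_le_iff₀ hS0]
    exact mul_le_mul_of_nonneg_left hyS hτ.le

theorem infEDist_outerLimitingSubdifferential_le_ebm [ProperSpace E]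
    (h : IsLipschitzBall g x r K) (h0 : g x = 0) :
    Metric.infEDist 0 (outerLimitingSubdifferential g x) ≤ ebm g x := by
  have hr := h.pos
  refine ENNReal.le_of_forall_nnreal_lt fun τ hτ => ?_
  rcases eq_zero_or_pos τ with rfl | hτ0
  · simp
  refine le_iSup₂ (f := fun (τ : ℝ≥0) (_ : IsErrorBoundConstant g x τ) => (τ : ℝ≥0∞)) τ
    ⟨hτ0, ?_⟩
  rw [← eventually_iff_exists_mem]
  by_contra hcon
  have hball : ∀ᶠ z in 𝓝 x, ‖z - x‖ < r / 2 := by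
    filter_upwards [Metric.ball_mem_nhds x (half_pos hr)] with z hz
    rwa [mem_ball_iff_norm] at hz
  obtain ⟨z, hz, hzk⟩ := exists_seq_forall_of_frequently
    ((not_eventually.1 hcon).and_eventually hball)
  have key (k : ℕ) : ∃ y v, v ∈ regularSubdifferential g y ∧ 0 < g y ∧
      ‖y - x‖ ≤ 2 * ‖z k - x‖ ∧ ‖v‖ ≤ τ := by
    obtain ⟨h1, h2⟩ := hzk k
    refine h.exists_regularSubgradient_norm_le h0 (NNReal.coe_pos.2 hτ0) h2 ?_
    have hzb : z k ∈ Metric.closedBall x r := by rw [mem_closedBall_iff_norm]; linarith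
    rw [not_le, coe_mul_infEDist ⟨x, h0.le⟩, ← h.coe_toReal hzb] at h1
    rw [max_lt_iff] at h1 ⊢
    exact ⟨EReal.coe_lt_coe_iff.1 h1.1, EReal.coe_pos.1 h1.2⟩
  choose y u hu hpos hy hnorm using key
  have hyx : Tendsto y atTop (𝓝 x) := by
    rw [tendsto_iff_norm_sub_tendsto_zero] at hz ⊢
    refine squeeze_zero (fun k => norm_nonneg _) hy ?_
    simpa using hz.const_mul 2
  obtain ⟨v, -, θ, hθ, hlim⟩ := h.exists_subseq_tendsto hyx hu
  have hv : v ∈ outerLimitingSubdifferential g x :=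
    ⟨h.finite x h.self_mem, y ∘ θ, u ∘ θ, hyx.comp hθ.tendsto_atTop,
      h.tendsto.comp (hyx.comp hθ.tendsto_atTop), fun k => by rw [h0]; exact hpos _,
      fun k => regularSubdifferential_subset_subdifferential _ _ (hu _), hlim⟩
  have hvn : ‖v‖ ≤ τ := le_of_tendsto' hlim.norm fun k => hnorm _
  refine hτ.not_ge ((Metric.infEDist_le_edist_of_mem hv).trans ?_)
  rw [edist_zero_left]
  exact ENNReal.coe_le_coe.2 (NNReal.coe_le_coe.1 hvn)

theorem le_norm_of_isErrorBoundConstant [ProperSpace E] (h : IsLipschitzBall g x r K)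
    (h0 : g x = 0) (hsub : subdifferential g x ⊆ regularSubdifferential g x) {τ : ℝ≥0}
    (hτ : IsErrorBoundConstant g x τ) {v : E}
    (hv : v ∈ positivelySupportedSet (subdifferential g x)) : (τ : ℝ) ≤ ‖v‖ := by
  obtain ⟨hτ0, U, hU, hUτ⟩ := hτ
  obtain ⟨hvD, w, hw, hmax⟩ := hv
  set m : ℝ := inner ℝ v w with hm
  have hτ0 : (0 : ℝ) < τ := hτ0
  have key : ∀ ε : ℝ, 0 < ε →
      m ≤ ε * (‖w‖ + (m + 2 * ε) / τ) + ‖v‖ * ((m + 2 * ε) / τ) := by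
    intro ε hε
    -- Bounds `‖z - x‖ / t` for the point `z` of the level set chosen near `x + t w` below.
    set M : ℝ := ‖w‖ + (m + 2 * ε) / τ with hM
    have hM0 : 0 < M := by positivity
    obtain ⟨ρ, hρ, hvρ⟩ := Metric.eventually_nhds_iff.1 ((hsub hvD).2 ε hε)
    have hup := h.eventually_toReal_le (w := w) (c := m + ε)
      fun v' hv' => (hmax v' hv').trans_lt (by linarith)
    have ht : Tendsto (fun t : ℝ => x + t • w) (𝓝[>] 0) (𝓝 x) := by
      have : Tendsto (fun t : ℝ => x + t • w) (𝓝 0) (𝓝 (x + (0 : ℝ) • w)) :=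
        Continuous.tendsto (by fun_prop) 0
      rw [zero_smul, add_zero] at this
      exact this.mono_left nhdsWithin_le_nhds
    have hsmall : ∀ᶠ t : ℝ in 𝓝[>] 0, t < ρ / M :=
      nhdsWithin_le_nhds (eventually_lt_nhds (div_pos hρ hM0))
    obtain ⟨t, ⟨⟨⟨h1, h2⟩, h3⟩, h4⟩, h5⟩ := ((((hup.and self_mem_nhdsWithin).and
      (ht.eventually hU)).and (ht.eventually h.closedBall_mem_nhds)).and hsmall).exists
    have h2 : 0 < t := h2
    rw [lt_div_iff₀ hM0] at h5
    have h6 := hUτ _ h3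
    rw [coe_mul_infEDist ⟨x, h0.le⟩, ← h.coe_toReal h4] at h6
    rw [h0, EReal.toReal_zero, zero_add] at h1
    have h7 : ((τ * Metric.infDist (x + t • w) (levelSet g) : ℝ) : EReal) ≤
        ((t * (m + ε) : ℝ) : EReal) :=
      h6.trans (max_le (EReal.coe_le_coe_iff.2 h1) (EReal.coe_nonneg.2 (by positivity)))
    rw [EReal.coe_le_coe_iff] at h7
    -- The second `ε` makes the inequality strict, so that a point at this distance can be chosen
    -- even if the infimum is not attained.
    have h8 : Metric.infDist (x + t • w) (levelSet g) < t * ((m + 2 * ε) / τ) := by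
      rw [← mul_div_assoc, lt_div_iff₀ hτ0, mul_comm]
      nlinarith
    obtain ⟨z, hz, hdz⟩ := (Metric.infDist_lt_iff ⟨x, h0.le⟩).1 h8
    rw [dist_eq_norm] at hdz
    have h9 : ‖z - x‖ ≤ t * M := by
      have e : z - x = t • w - (x + t • w - z) := by abel
      rw [e]
      refine (norm_sub_le _ _).trans ?_
      rw [norm_smul, Real.norm_of_nonneg h2.le, hM, mul_add]
      linarith
    have h10 := (hvρ (y := z) (by rw [dist_eq_norm]; linarith)).trans hz
    rw [h0, EReal.toReal_zero, zero_add, ← EReal.coe_zero, EReal.coe_le_coe_iff] at h10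
    -- The first summand is at most `ε ‖z - x‖`, as `g z ≤ 0`; the second is controlled by
    -- Cauchy–Schwarz.
    have h11 : t * m = inner ℝ v (z - x) + inner ℝ v (x + t • w - z) := by
      rw [hm, ← inner_smul_right, ← inner_add_right]
      congr 1
      abel
    have h12 := real_inner_le_norm v (x + t • w - z)
    have h13 : ‖v‖ * ‖x + t • w - z‖ ≤ ‖v‖ * (t * ((m + 2 * ε) / τ)) :=
      mul_le_mul_of_nonneg_left hdz.le (norm_nonneg v)
    have h14 := mul_le_mul_of_nonneg_left h9 hε.le
    refine le_of_mul_le_mul_left ?_ h2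
    linarith
  have hlim : Tendsto (fun ε : ℝ => ε * (‖w‖ + (m + 2 * ε) / τ) + ‖v‖ * ((m + 2 * ε) / τ))
      (𝓝[>] 0) (𝓝 (0 * (‖w‖ + (m + 2 * 0) / τ) + ‖v‖ * ((m + 2 * 0) / τ))) :=
    (Continuous.tendsto (by fun_prop) 0).mono_left nhdsWithin_le_nhds
  -- In the limit `m ≤ ‖v‖ m / τ`, and `m > 0` cancels.
  have h1 := ge_of_tendsto hlim
    (by filter_upwards [self_mem_nhdsWithin] with ε hε using key ε hε)
  rw [zero_mul, zero_add, mul_zero, add_zero, ← mul_div_assoc, le_div_iff₀ hτ0, mul_comm] at h1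
  exact le_of_mul_le_mul_right h1 hw

theorem ebm_le_infEDist_positivelySupportedSet [ProperSpace E] (h : IsLipschitzBall g x r K)
    (h0 : g x = 0) (hsub : subdifferential g x ⊆ regularSubdifferential g x) :
    ebm g x ≤ Metric.infEDist 0 (positivelySupportedSet (subdifferential g x)) := by
  refine iSup₂_le fun τ hτ => Metric.le_infEDist.2 fun v hv => ?_
  rw [edist_zero_left]
  exact ENNReal.coe_le_coe.2 (NNReal.coe_le_coe.1 (h.le_norm_of_isErrorBoundConstant h0 hsub hτ hv))

end IsLipschitzBall

end Modulus

end

end ErrorBound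

theorem mainTheorem1 (n : ℕ) (φ : EuclideanSpace ℝ (Fin n) → EReal)
    (hφ : ∀ x, φ x ≠ ⊥) (xbar : EuclideanSpace ℝ (Fin n))
    (hx : xbar ∈ frontier (ErrorBound.levelSet φ))
    (hreg : ErrorBound.IsRegularAt φ xbar)
    (hlip : ErrorBound.IsLocallyLipschitzAt φ xbar) :
    Metric.infEDist 0 (ErrorBound.outerLimitingSubdifferential φ xbar) ≤ ErrorBound.ebm φ xbar ∧
    ErrorBound.ebm φ xbar ≤
      Metric.infEDist 0 (ErrorBound.outerLimitingSubdifferential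
        (ErrorBound.supportFunction (ErrorBound.subdifferential φ xbar)) 0) ∧
    Metric.infEDist 0 (ErrorBound.outerLimitingSubdifferential
        (ErrorBound.supportFunction (ErrorBound.subdifferential φ xbar)) 0) =
      Metric.infEDist 0 (ErrorBound.endSet (ErrorBound.subdifferential φ xbar)) := by
  obtain ⟨r, K, h⟩ := hlip.exists_isLipschitzBall
  have h0 := ErrorBound.eq_zero_of_mem_frontier_levelSet h.tendsto hx
  have hD := hreg.subdifferential_eq
  have hcomp : IsCompact (ErrorBound.subdifferential φ xbar) :=
    hD ▸ h.isCompact_regularSubdifferential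
  have hconv : Convex ℝ (ErrorBound.subdifferential φ xbar) :=
    hD ▸ ErrorBound.convex_regularSubdifferential φ xbar
  rw [ErrorBound.infEDist_outerLimitingSubdifferential_supportFunction hcomp hconv,
    ErrorBound.infEDist_endSet hcomp hconv]
  exact ⟨h.infEDist_outerLimitingSubdifferential_le_ebm h0,
    h.ebm_le_infEDist_positivelySupportedSet h0 hD.subset, rfl⟩
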